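/- Let $\{F_\theta:\theta\in\Theta\}$ be a family of continuous cumulative distribution functions on $\mathbb R$, indexed by a topological space $\Theta$. Let $x_1,x_2,\dots$ be i.i.d. real random variables with true distribution $F_{true}$, and let $\theta_0\in\Theta$ minimize $\theta\mapsto D(F_{true},F_\theta)$ over $\Theta$, where $D\ge 0$ is a divergence, i.e. $D(F,G)=0$ if and only if $F=G$ (for $G$ a continuous cdf). Let $\mathcal H_0$ be the hypothesis $F_{true}\in\{F_\theta:\theta\in\Theta\}$. For a cdf $F$ and a cdf $G$ let $d_{CvM}(F,G)=\int_{-\infty}^{\infty}(F(z)-G(z))^2\,G(dz)$. Let $a>0$ and let $H$ be a probability measure on $\mathbb R$, which may depend on the sample $x=(x_1,\dots,x_n)$. For every $n$ let $P=P_n$ be a random probability measure on $\mathbb R$ (identified with its cdf) whose conditional distribution given $x$ is the Dirichlet process $DP(a+n,H_x)$, where $H_x=\frac{a}{a+n}H+\frac{n}{a+n}F_n$ and $F_n=\frac1n\sum_{i=1}^n\delta_{x_i}$; that is, for every finite measurable partition $A_1,\dots,A_k$ of $\mathbb R$ with $k\ge 2$, the vector $(P(A_1),\dots,P(A_k))$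 has, given $x$, the Dirichlet distribution with parameters $((a+n)H_x(A_1),\dots,(a+n)H_x(A_k))$, where a coordinate with parameter $0$ is $0$ almost surely. The $P_n$ are defined on one probability space, with no assumption on their joint distribution across different $n$. Let $\theta(x)=\theta_n(x_1,\dots,x_n)\in\Theta$ be an estimator such that, as $n\to\infty$, $\theta(x)\to\theta_0$ a.s. and $\sup_{z\in\mathbb R}|F_{\theta(x)}(z)-F_{\theta_0}(z)|\to 0$ a.s. Then, as $n\to\infty$: (i) if $\mathcal H_0$ is true, then $d_{CvM}(P,F_{\theta(x)})\to 0$ a.s.; (ii) if $\mathcal H_0$ is false, then $\liminf d_{CvM}(P,F_{\theta(x)})>0$ a.s. -/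

import Mathlib

open MeasureTheory ProbabilityTheory Filter
open scoped Topology ENNReal

noncomputable section

/-- The Gamma distribution with shape `α` and scale `1`, with the usual convention that shape
`0` is the point mass at `0`. -/
def gammaLaw (α : ℝ) : Measure ℝ :=
  if 0 < α then gammaMeasure α 1 else Measure.dirac 0

instance gammaLaw.instIsProbabilityMeasure (α : ℝ) : IsProbabilityMeasure (gammaLaw α) := by
  unfold gammaLaw
  split_ifs with h
  · exact isProbabilityMeasure_gammaMeasure h one_pos
  · infer_instance

/-- The Dirichlet distribution with nonnegative parameters `α i`, not all zero: the law of
`Z / ∑ j, Z j` for independent `Z i ∼ Gamma (α i, 1)`. A coordinate with parameter `0` vanishes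
almost surely. -/
def dirichletLaw {ι : Type*} [Fintype ι] (α : ι → ℝ) : Measure (ι → ℝ) :=
  (Measure.pi fun i => gammaLaw (α i)).map fun z i => z i / ∑ j, z j

/-- `IsDirichletProcess 𝓓 a H`: the law `𝓓` of a random probability measure `P` is the Dirichlet
process `DP(a, H)`, i.e. for every finite measurable partition `A 0, …, A (k - 1)` with `k ≥ 2`
the vector `(P (A 0), …, P (A (k - 1)))` has the Dirichlet distribution with parameters
`a * H (A 0), …, a * H (A (k - 1))`. -/
def IsDirichletProcess {S : Type*} [MeasurableSpace S] (𝓓 : Measure (ProbabilityMeasure S))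
    (a : ℝ) (H : Measure S) : Prop :=
  ∀ (k : ℕ) (A : Fin k → Set S), 2 ≤ k → (∀ i, MeasurableSet (A i)) →
    Pairwise (fun i j => Disjoint (A i) (A j)) → (⋃ i, A i) = Set.univ →
    HasLaw (fun (p : ProbabilityMeasure S) (i : Fin k) => (p : Measure S).real (A i))
      (dirichletLaw fun i => a * H.real (A i)) 𝓓

/-- The empirical distribution `n⁻¹ ∑ i, δ_{x i}` of a sample of size `n`
(the zero measure for `n = 0`). -/
def empiricalDistribution {n : ℕ} (x : Fin n → ℝ) : Measure ℝ :=
  ENNReal.ofReal ((n : ℝ)⁻¹) • ∑ i, Measure.dirac (x i)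

/-- The posterior base measure `H_x = a / (a + n) H + n / (a + n) F_n`. -/
def posteriorBase (a : ℝ) (H : Measure ℝ) {n : ℕ} (x : Fin n → ℝ) : Measure ℝ :=
  ENNReal.ofReal (a / (a + n)) • H + ENNReal.ofReal (n / (a + n)) • empiricalDistribution x

/-- `P ∣ x ∼ DP(a + n, H_x)`: the conditional distribution of the random probability measure
`P`, given that the sample `X = (X 0, …, X (n - 1))` takes the value `x`, is
`DP(a + n, H_x)`, where the base measure `H x` of the prior may depend on the sample. -/
def IsPosteriorDirichletProcess {Ω : Type*} [MeasurableSpace Ω] (μ : Measure Ω) {n : ℕ}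
    (P : Ω → ProbabilityMeasure ℝ) (X : Ω → Fin n → ℝ) (a : ℝ)
    (H : (Fin n → ℝ) → ProbabilityMeasure ℝ) : Prop :=
  ∃ κ : Kernel (Fin n → ℝ) (ProbabilityMeasure ℝ), IsMarkovKernel κ ∧
    HasCondDistrib P X κ μ ∧
    ∀ᵐ x ∂(μ.map X), IsDirichletProcess (κ x) (a + n) (posteriorBase a (H x : Measure ℝ) x)

/-- The Cramér–von Mises distance `∫ (F(z) - G(z))² G(dz)` of the cdf's of two probability
measures on the line. -/
def dCvM (F G : ProbabilityMeasure ℝ) : ℝ :=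
  ∫ z, (cdf (F : Measure ℝ) z - cdf (G : Measure ℝ) z) ^ 2 ∂(G : Measure ℝ)

/-- A divergence of a distribution from a distribution with continuous cdf: a `[0, ∞]`-valued
quantity that vanishes exactly when the two distributions coincide. -/
def IsDivergence (D : ProbabilityMeasure ℝ → ProbabilityMeasure ℝ → ℝ≥0∞) : Prop :=
  ∀ μ ν : ProbabilityMeasure ℝ, Continuous (cdf (ν : Measure ℝ)) → (D μ ν = 0 ↔ μ = ν)

/-- The first `n` observations. -/
def firstSample {Ω : Type*} (X : ℕ → Ω → ℝ) (n : ℕ) (ω : Ω) : Fin n → ℝ := fun i => X i ω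

end

/-! For a fixed measurable set, the posterior mass under `DP(a + n, H_x)` has a Beta law with
parameter sum `a + n`. Fourth moments of Gamma variables give it a tail of order `n⁻²` around `H_x`,
which differs from the empirical measure by at most `a / (a + n)`. This tail is summable, so
Borel–Cantelli, which needs no joint law of the `P n`, and the strong law give
`tendsto_real_posterior`: almost surely the posterior cdf's converge to that of `Q` at every
rational.

If `Q` is in the model, minimality forces `Q = F θ₀`; Pólya's theorem makes the convergence uniform,
and the squared uniform distance bounds `dCvM`. Otherwise the two cdf's differ at some rational, and
`abs_cdf_sub_cdf_pow_le_dCvM` turns this gap into a positive lower bound. -/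

/-! ### Moments and tails of the Gamma distribution -/

lemma gammaPDFReal_mul_pow {α : ℝ} (hα : 0 < α) (k : ℕ) {x : ℝ} (hx : x ≠ 0) :
    gammaPDFReal α 1 x * x ^ k =
      Real.Gamma (α + k) / Real.Gamma α * gammaPDFReal (α + k) 1 x := by
  have h1 := (Real.Gamma_pos_of_pos hα).ne'
  have h2 := (Real.Gamma_pos_of_pos (show 0 < α + k by positivity)).ne'
  unfold gammaPDFReal
  split_ifs with h
  · have : x ^ (α + k - 1) = x ^ (α - 1) * x ^ k := by
      rw [← Real.rpow_natCast x k, ← Real.rpow_add (lt_of_le_of_ne h hx.symm)]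
      ring_nf
    rw [this, Real.one_rpow, Real.one_rpow]
    field_simp
  · simp

lemma integrable_gammaPDFReal {α : ℝ} (hα : 0 < α) : Integrable (gammaPDFReal α 1) := by
  refine ⟨(measurable_gammaPDFReal α 1).aestronglyMeasurable, ?_⟩
  rw [hasFiniteIntegral_iff_ofReal (ae_of_all _ (gammaPDFReal_nonneg hα one_pos))]
  have := lintegral_gammaPDF_eq_one hα one_pos
  simp only [gammaPDF] at this
  simp [this]

lemma integral_gammaPDFReal {α : ℝ} (hα : 0 < α) : ∫ x, gammaPDFReal α 1 x = 1 := by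
  rw [integral_eq_lintegral_of_nonneg_ae (ae_of_all _ (gammaPDFReal_nonneg hα one_pos))
    (measurable_gammaPDFReal α 1).aestronglyMeasurable]
  have := lintegral_gammaPDF_eq_one hα one_pos
  simp only [gammaPDF] at this
  simp [this]

lemma measurable_gammaPDF (α : ℝ) : Measurable (gammaPDF α 1) :=
  (measurable_gammaPDFReal α 1).ennreal_ofReal

lemma gammaPDFReal_mul_pow_ae {α : ℝ} (hα : 0 < α) (k : ℕ) :
    (fun x => Real.Gamma (α + k) / Real.Gamma α * gammaPDFReal (α + k) 1 x) =ᵐ[volume]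
      fun x => gammaPDFReal α 1 x * x ^ k := by
  filter_upwards [Measure.ae_ne volume (0 : ℝ)] with x hx
  exact (gammaPDFReal_mul_pow hα k hx).symm

lemma integrable_pow_gammaMeasure {α : ℝ} (hα : 0 < α) (k : ℕ) :
    Integrable (fun x => x ^ k) (gammaMeasure α 1) := by
  have hk : 0 < α + k := by positivity
  unfold gammaMeasure
  rw [integrable_withDensity_iff (measurable_gammaPDF α)
    (ae_of_all _ fun _ => ENNReal.ofReal_lt_top)]
  refine (((integrable_gammaPDFReal hk).const_mul _).congr
    (gammaPDFReal_mul_pow_ae hα k)).congr (ae_of_all _ fun x => ?_)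
  simp [gammaPDF, gammaPDFReal_nonneg hα one_pos x, mul_comm]

/-- Multiplying the density by `x ^ k` gives a multiple of the density of shape `α + k`, which has
mass one. -/
lemma integral_pow_gammaMeasure {α : ℝ} (hα : 0 < α) (k : ℕ) :
    ∫ x, x ^ k ∂gammaMeasure α 1 = Real.Gamma (α + k) / Real.Gamma α := by
  have hk : 0 < α + k := by positivity
  unfold gammaMeasure
  rw [integral_withDensity_eq_integral_toReal_smul
    (measurable_gammaPDF α) (ae_of_all _ fun _ => ENNReal.ofReal_lt_top)]
  calc _ = ∫ x, gammaPDFReal α 1 x * x ^ k := by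
        simp [gammaPDF, gammaPDFReal_nonneg hα one_pos]
    _ = _ := by
        rw [← integral_congr_ae (gammaPDFReal_mul_pow_ae hα k), integral_const_mul,
          integral_gammaPDFReal hk, mul_one]

/-- The fourth central moment of the Gamma distribution. -/
lemma integral_sub_pow_four_gammaMeasure {α : ℝ} (hα : 0 < α) :
    Integrable (fun x => (x - α) ^ 4) (gammaMeasure α 1) ∧
      ∫ x, (x - α) ^ 4 ∂gammaMeasure α 1 = 3 * α ^ 2 + 6 * α := by
  have : IsProbabilityMeasure (gammaMeasure α 1) := isProbabilityMeasure_gammaMeasure hα one_pos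
  have hi := integrable_pow_gammaMeasure hα
  have e : ∀ x : ℝ, (x - α) ^ 4 =
      x ^ 4 + (-4 * α) * x ^ 3 + 6 * α ^ 2 * x ^ 2 + (-4 * α ^ 3) * x ^ 1 + α ^ 4 := fun x => by ring
  have i3 := (hi 3).const_mul (-4 * α)
  have i2 := (hi 2).const_mul (6 * α ^ 2)
  have i1 := (hi 1).const_mul (-4 * α ^ 3)
  have i43 := (hi 4).fun_add i3
  have i432 := i43.fun_add i2
  have i4321 := i432.fun_add i1
  have h0 := (Real.Gamma_pos_of_pos hα).ne'
  have g1 : Real.Gamma (α + 1) = α * Real.Gamma α := Real.Gamma_add_one hα.ne'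
  have g2 : Real.Gamma (α + 2) = (α + 1) * (α * Real.Gamma α) := by
    rw [← g1, ← Real.Gamma_add_one (by positivity)]; ring_nf
  have g3 : Real.Gamma (α + 3) = (α + 2) * ((α + 1) * (α * Real.Gamma α)) := by
    rw [← g2, ← Real.Gamma_add_one (by positivity)]; ring_nf
  have g4 : Real.Gamma (α + 4) = (α + 3) * ((α + 2) * ((α + 1) * (α * Real.Gamma α))) := by
    rw [← g3, ← Real.Gamma_add_one (by positivity)]; ring_nf
  simp only [e]
  refine ⟨i4321.fun_add (integrable_const _), ?_⟩
  rw [integral_add i4321 (integrable_const _), integral_add i432 i1, integral_add i43 i2,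
    integral_add (hi 4) i3]
  simp only [integral_const_mul, integral_pow_gammaMeasure hα]
  push_cast
  rw [g1, g2, g3, g4]
  simp
  field_simp
  ring

/-- Markov's inequality for the fourth power. With `δ` of order `N ≥ α` the bound is of order `N⁻²`;
the variance would only give `N⁻¹`, which is not summable. -/
lemma gammaLaw_le_abs_sub {α δ : ℝ} (hα : 0 ≤ α) (hδ : 0 < δ) :
    gammaLaw α {x | δ ≤ |x - α|} ≤ ENNReal.ofReal ((3 * α ^ 2 + 6 * α) / δ ^ 4) := by
  rcases hα.eq_or_lt with rfl | hα
  · have : gammaLaw 0 {x | δ ≤ |x - 0|} = 0 := by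
      simp [gammaLaw, hδ]
    rw [this]; exact zero_le
  · have : IsProbabilityMeasure (gammaMeasure α 1) := isProbabilityMeasure_gammaMeasure hα one_pos
    obtain ⟨hi, he⟩ := integral_sub_pow_four_gammaMeasure hα
    have h := mul_meas_ge_le_integral_of_nonneg (ae_of_all _ fun x => by positivity) hi (δ ^ 4)
    rw [he] at h
    have hs : {x : ℝ | δ ≤ |x - α|} ⊆ {x | δ ^ 4 ≤ (x - α) ^ 4} := fun x hx => by
      have := pow_le_pow_left₀ hδ.le hx 4
      rwa [pow_abs, abs_of_nonneg (by positivity)] at this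
    rw [gammaLaw, if_pos hα, ENNReal.le_ofReal_iff_toReal_le (measure_ne_top _ _) (by positivity),
      le_div_iff₀ (by positivity), mul_comm]
    refine le_trans ?_ h
    gcongr
    exact measureReal_mono hs

/-! ### Concentration of the Dirichlet process on a set -/

/-- The total `u + v` stays above half of `s + t`, so the error in the ratio is controlled by the
errors in its parts. No sign of `u` or `v` is assumed, so the support of the Gamma law never enters.
-/
lemma abs_div_add_sub_div_add_lt {u v s t ε : ℝ} (hs : 0 ≤ s) (ht : 0 ≤ t) (hst : 0 < s + t)
    (hε1 : ε ≤ 1) (hu : |u - s| < ε / 4 * (s + t))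
    (hv : |v - t| < ε / 4 * (s + t)) : |u / (u + v) - s / (s + t)| < ε := by
  have hε : 0 < ε := by
    by_contra h
    nlinarith [abs_nonneg (u - s)]
  have hu' := abs_lt.1 hu
  have hv' := abs_lt.1 hv
  have hS : (s + t) / 2 ≤ u + v := by nlinarith
  have hS0 : 0 < u + v := by linarith
  have e : u / (u + v) - s / (s + t) = ((u - s) * t - s * (v - t)) / ((u + v) * (s + t)) := by
    field_simp
    ring
  rw [e, abs_div, abs_of_pos (mul_pos hS0 hst), div_lt_iff₀ (mul_pos hS0 hst)]
  calc |(u - s) * t - s * (v - t)| ≤ |(u - s) * t| + |s * (v - t)| := abs_sub _ _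
    _ = |u - s| * t + s * |v - t| := by rw [abs_mul, abs_mul, abs_of_nonneg hs, abs_of_nonneg ht]
    _ ≤ ε / 4 * (s + t) * t + s * (ε / 4 * (s + t)) := by gcongr
    _ = ε / 2 * ((s + t) / 2 * (s + t)) := by ring
    _ < ε * ((s + t) / 2 * (s + t)) := by gcongr; linarith
    _ ≤ ε * ((u + v) * (s + t)) := by gcongr

/-- A tail bound for the Beta distribution, seen as a Dirichlet distribution with two
coordinates. -/
lemma dirichletLaw_le_abs_sub {α : Fin 2 → ℝ} (hα : ∀ i, 0 ≤ α i) (hN : 1 ≤ α 0 + α 1)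
    {ε : ℝ} (hε : 0 < ε) (hε1 : ε ≤ 1) :
    dirichletLaw α {v | ε ≤ |v 0 - α 0 / (α 0 + α 1)|} ≤
      ENNReal.ofReal (4608 / (ε ^ 4 * (α 0 + α 1) ^ 2)) := by
  set N := α 0 + α 1 with hNdef
  have hδ : 0 < ε / 4 * N := by positivity
  have hmeas : MeasurableSet {v : Fin 2 → ℝ | ε ≤ |v 0 - α 0 / N|} :=
    measurableSet_le (by fun_prop) (by fun_prop)
  have hbound (i : Fin 2) : (Measure.pi fun i => gammaLaw (α i)) {z | ε / 4 * N ≤ |z i - α i|} ≤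
      ENNReal.ofReal (2304 / (ε ^ 4 * N ^ 2)) := by
    have h := (measurePreserving_eval (fun i => gammaLaw (α i)) i).measure_preimage
      (s := {x | ε / 4 * N ≤ |x - α i|})
      (measurableSet_le (by fun_prop) (by fun_prop)).nullMeasurableSet
    calc _ = gammaLaw (α i) {x | ε / 4 * N ≤ |x - α i|} := h
      _ ≤ ENNReal.ofReal ((3 * α i ^ 2 + 6 * α i) / (ε / 4 * N) ^ 4) :=
        gammaLaw_le_abs_sub (hα i) hδ
      _ ≤ _ := by
        apply ENNReal.ofReal_le_ofReal
        have hi : α i ≤ N := by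
          fin_cases i
          · simpa [hNdef] using hα 1
          · simpa [hNdef] using hα 0
        -- `1 ≤ N` absorbs the linear term. Then `9 * 4 ^ 4 = 2304`, and the two coordinates
        -- together give `4608`.
        have h9 : 3 * α i ^ 2 + 6 * α i ≤ 9 * N ^ 2 := by nlinarith [hα i]
        calc _ ≤ 9 * N ^ 2 / (ε / 4 * N) ^ 4 := by gcongr
          _ = _ := by field_simp; norm_num
  rw [dirichletLaw, Measure.map_apply (by fun_prop) hmeas]
  calc _ ≤ (Measure.pi fun i => gammaLaw (α i))
        ({z | ε / 4 * N ≤ |z 0 - α 0|} ∪ {z | ε / 4 * N ≤ |z 1 - α 1|}) := by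
        refine measure_mono fun z hz => ?_
        by_contra hcon
        simp only [Set.mem_union, Set.mem_ofPred_eq, not_or, not_le] at hcon
        have hz' : ε ≤ |z 0 / ∑ j, z j - α 0 / N| := hz
        rw [Fin.sum_univ_two] at hz'
        exact absurd hz' (not_le.2 (abs_div_add_sub_div_add_lt (hα 0) (hα 1) (by linarith)
          hε1 hcon.1 hcon.2))
    _ ≤ _ := measure_union_le _ _
    _ ≤ _ := add_le_add (hbound 0) (hbound 1)
    _ = _ := by
        rw [← ENNReal.ofReal_add (by positivity) (by positivity)]
        congr 1
        ring

lemma IsDirichletProcess.measure_le_abs_sub {S : Type*} [MeasurableSpace S]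
    {𝓓 : Measure (ProbabilityMeasure S)} {N : ℝ} {H : Measure S} [IsProbabilityMeasure H]
    (h : IsDirichletProcess 𝓓 N H) (hN : 1 ≤ N) {A : Set S} (hA : MeasurableSet A)
    {ε : ℝ} (hε : 0 < ε) (hε1 : ε ≤ 1) :
    𝓓 {p | ε ≤ |(p : Measure S).real A - H.real A|} ≤
      ENNReal.ofReal (4608 / (ε ^ 4 * N ^ 2)) := by
  have hlaw := h 2 ![A, Aᶜ] le_rfl
    (by intro i; fin_cases i; exacts [hA, hA.compl])
    (by
      intro i j hij
      fin_cases i <;> fin_cases j <;> simp_all [disjoint_compl_left, disjoint_compl_right])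
    (by
      ext x
      simp only [Set.mem_iUnion, Fin.exists_fin_two, Set.mem_univ, iff_true]
      exact em _)
  have hsum : N * H.real A + N * H.real Aᶜ = N := by
    rw [← mul_add, probReal_add_probReal_compl hA, mul_one]
  have hb := dirichletLaw_le_abs_sub (α := fun i => N * H.real (![A, Aᶜ] i))
    (fun i => by positivity) (by simp [hsum, hN]) hε hε1
  simp only [Matrix.cons_val_zero, Matrix.cons_val_one, hsum] at hb
  rw [mul_div_cancel_left₀ _ (by positivity)] at hb
  rw [← hlaw.measure_eq (measurableSet_le (by fun_prop) (by fun_prop))] at hb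
  exact hb

/-! ### Empirical measure and posterior consistency -/

lemma isProbabilityMeasure_empiricalDistribution {n : ℕ} (hn : n ≠ 0) (x : Fin n → ℝ) :
    IsProbabilityMeasure (empiricalDistribution x) := by
  constructor
  have hn' : (0 : ℝ) < n := by positivity
  simp only [empiricalDistribution, Measure.smul_apply, Measure.finsetSum_apply, measure_univ,
    Finset.sum_const, Finset.card_univ, Fintype.card_fin, smul_eq_mul, nsmul_eq_mul, mul_one]
  rw [← ENNReal.ofReal_natCast, ← ENNReal.ofReal_mul (by positivity), inv_mul_cancel₀ hn'.ne',
    ENNReal.ofReal_one]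

lemma isProbabilityMeasure_posteriorBase {a : ℝ} (ha : 0 < a) (H : Measure ℝ)
    [IsProbabilityMeasure H] {n : ℕ} (hn : n ≠ 0) (x : Fin n → ℝ) :
    IsProbabilityMeasure (posteriorBase a H x) := by
  have := isProbabilityMeasure_empiricalDistribution hn x
  constructor
  simp only [posteriorBase, Measure.add_apply, Measure.smul_apply, measure_univ, smul_eq_mul,
    mul_one]
  rw [← ENNReal.ofReal_add (by positivity) (by positivity), ← add_div, div_self (by positivity),
    ENNReal.ofReal_one]

lemma real_posteriorBase {a : ℝ} (ha : 0 < a) (H : Measure ℝ)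
    [IsProbabilityMeasure H] {n : ℕ} (hn : n ≠ 0) (x : Fin n → ℝ) (A : Set ℝ) :
    (posteriorBase a H x).real A =
      a / (a + n) * H.real A + n / (a + n) * (empiricalDistribution x).real A := by
  have := isProbabilityMeasure_empiricalDistribution hn x
  unfold posteriorBase
  rw [measureReal_add_apply (ENNReal.mul_ne_top ENNReal.ofReal_ne_top (measure_ne_top _ _))
    (ENNReal.mul_ne_top ENNReal.ofReal_ne_top (measure_ne_top _ _))]
  simp only [measureReal_ennreal_smul_apply]
  rw [ENNReal.toReal_ofReal (by positivity), ENNReal.toReal_ofReal (by positivity)]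

/-- The bound is uniform in `H`, which is why the prior base measure may depend on the sample. -/
lemma abs_real_posteriorBase_sub_le {a : ℝ} (ha : 0 < a) (H : Measure ℝ)
    [IsProbabilityMeasure H] {n : ℕ} (hn : n ≠ 0) (x : Fin n → ℝ) (A : Set ℝ) :
    |(posteriorBase a H x).real A - (empiricalDistribution x).real A| ≤ a / (a + n) := by
  have := isProbabilityMeasure_empiricalDistribution hn x
  have e : (posteriorBase a H x).real A - (empiricalDistribution x).real A =
      a / (a + n) * (H.real A - (empiricalDistribution x).real A) := by
    rw [real_posteriorBase ha H hn]
    field_simp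
    ring
  rw [e, abs_mul, abs_of_nonneg (by positivity)]
  refine mul_le_of_le_one_right (by positivity) (abs_le.2 ?_)
  have h1 := measureReal_le_one (μ := H) (s := A)
  have h2 := measureReal_le_one (μ := empiricalDistribution x) (s := A)
  have h3 := measureReal_nonneg (μ := H) (s := A)
  have h4 := measureReal_nonneg (μ := empiricalDistribution x) (s := A)
  constructor <;> linarith

lemma real_empiricalDistribution {n : ℕ} (x : Fin n → ℝ) {A : Set ℝ} (hA : MeasurableSet A) :
    (empiricalDistribution x).real A = (n : ℝ)⁻¹ * ∑ i, A.indicator (fun _ => 1) (x i) := by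
  simp only [empiricalDistribution, Measure.real, Measure.smul_apply, Measure.finsetSum_apply,
    smul_eq_mul, ENNReal.toReal_mul]
  rw [ENNReal.toReal_ofReal (by positivity), ENNReal.toReal_sum (fun i _ => measure_ne_top _ _)]
  congr 1
  refine Finset.sum_congr rfl fun i _ => ?_
  rw [Measure.dirac_apply' _ hA]
  by_cases h : x i ∈ A <;> simp [h]

lemma measurable_real_empiricalDistribution {n : ℕ} {A : Set ℝ} (hA : MeasurableSet A) :
    Measurable fun x : Fin n → ℝ => (empiricalDistribution x).real A := by
  simp only [real_empiricalDistribution _ hA]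
  refine (Finset.measurable_sum _ fun i _ => ?_).const_mul _
  exact (measurable_const.indicator hA).comp (measurable_pi_apply i)

/-- Given the sample, the posterior Dirichlet process is concentrated near the empirical
distribution. -/
lemma IsPosteriorDirichletProcess.measure_le_abs_sub {Ω : Type*} [MeasurableSpace Ω]
    {μ : Measure Ω} [IsProbabilityMeasure μ] {n : ℕ} {P : Ω → ProbabilityMeasure ℝ}
    {X : Ω → Fin n → ℝ} {a : ℝ} {H : (Fin n → ℝ) → ProbabilityMeasure ℝ}
    (h : IsPosteriorDirichletProcess μ P X a H) (ha : 0 < a) (hn : n ≠ 0)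
    {A : Set ℝ} (hA : MeasurableSet A) {ε : ℝ} (hε : 0 < ε) (hε1 : ε ≤ 1) :
    μ {ω | ε + a / (a + n) ≤ |(P ω : Measure ℝ).real A - (empiricalDistribution (X ω)).real A|} ≤
      ENNReal.ofReal (4608 / (ε ^ 4 * (a + n) ^ 2)) := by
  obtain ⟨κ, hκ, hcond, hae⟩ := h
  have hmp : Measurable fun p : ProbabilityMeasure ℝ => (p : Measure ℝ).real A :=
    ((Measure.measurable_coe hA).comp measurable_subtype_coe).ennreal_toReal
  have hms : MeasurableSet {q : (Fin n → ℝ) × ProbabilityMeasure ℝ |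
      ε + a / (a + n) ≤ |(q.2 : Measure ℝ).real A - (empiricalDistribution q.1).real A|} :=
    measurableSet_le measurable_const
      ((hmp.comp measurable_snd).sub
        ((measurable_real_empiricalDistribution hA).comp measurable_fst)).abs
  have := Measure.isProbabilityMeasure_map (μ := μ) hcond.aemeasurable_fst
  have hlaw : HasLaw (fun ω => (X ω, P ω)) (μ.map X ⊗ₘ κ) μ := hcond
  rw [hlaw.measure_eq hms, Measure.compProd_apply hms]
  have hn1 : (1 : ℝ) ≤ n := by exact_mod_cast Nat.one_le_iff_ne_zero.2 hn
  calc _ ≤ ∫⁻ _, ENNReal.ofReal (4608 / (ε ^ 4 * (a + n) ^ 2)) ∂(μ.map X) := by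
        refine lintegral_mono_ae ?_
        filter_upwards [hae] with x hx
        have := isProbabilityMeasure_posteriorBase ha (H x : Measure ℝ) hn x
        -- The slack `a / (a + n)` pays for replacing the empirical measure by `H_x`.
        refine le_trans (measure_mono fun p hp => ?_)
          (hx.measure_le_abs_sub (by linarith) hA hε hε1)
        have hp' : ε + a / (a + n) ≤
          |(p : Measure ℝ).real A - (empiricalDistribution x).real A| := hp
        have h1 := abs_real_posteriorBase_sub_le ha (H x : Measure ℝ) hn x A
        have h2 := abs_sub_le ((p : Measure ℝ).real A)
          ((posteriorBase a (H x : Measure ℝ) x).real A) ((empiricalDistribution x).real A)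
        simp only [Set.mem_ofPred_eq]
        linarith
    _ = _ := by simp

/-- The strong law of large numbers for the empirical distribution of a measurable set. -/
lemma tendsto_real_empiricalDistribution {Ω : Type*} [MeasurableSpace Ω] {μ : Measure Ω}
    {Q : Measure ℝ} [IsProbabilityMeasure Q] {X : ℕ → Ω → ℝ} (hXindep : iIndepFun X μ)
    (hXlaw : ∀ i, HasLaw (X i) Q μ) {A : Set ℝ} (hA : MeasurableSet A) :
    ∀ᵐ ω ∂μ, Tendsto (fun n => (empiricalDistribution (firstSample X n ω)).real A) atTop
      (𝓝 (Q.real A)) := by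
  have hm : Measurable (A.indicator fun _ : ℝ => (1 : ℝ)) := measurable_const.indicator hA
  have hint : Integrable (fun ω => A.indicator (fun _ => (1 : ℝ)) (X 0 ω)) μ := by
    have : Integrable (A.indicator fun _ : ℝ => (1 : ℝ)) (μ.map (X 0)) := by
      rw [(hXlaw 0).map_eq]
      exact (integrable_const 1).indicator hA
    exact this.comp_aemeasurable (hXlaw 0).aemeasurable
  have hlim : ∫ ω, A.indicator (fun _ => (1 : ℝ)) (X 0 ω) ∂μ = Q.real A := by
    rw [← integral_map (hXlaw 0).aemeasurable hm.aestronglyMeasurable, (hXlaw 0).map_eq,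
      integral_indicator hA]
    simp
  have hlln := strong_law_ae_real (fun i ω => A.indicator (fun _ => (1 : ℝ)) (X i ω)) hint
    (fun i j hij => (hXindep.indepFun hij).comp hm hm)
    (fun i => IdentDistrib.comp ⟨(hXlaw i).aemeasurable, (hXlaw 0).aemeasurable, by
      rw [(hXlaw i).map_eq, (hXlaw 0).map_eq]⟩ hm)
  filter_upwards [hlln] with ω hω
  rw [hlim] at hω
  refine hω.congr fun n => ?_
  rw [real_empiricalDistribution _ hA, div_eq_inv_mul,
    Finset.sum_range (fun i => A.indicator (fun _ => (1 : ℝ)) (X i ω))]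
  rfl

/-- The posterior Dirichlet processes are consistent on every measurable set. -/
lemma tendsto_real_posterior {Ω : Type*} [MeasurableSpace Ω] {μ : Measure Ω}
    [IsProbabilityMeasure μ] {Q : Measure ℝ} [IsProbabilityMeasure Q] {X : ℕ → Ω → ℝ}
    (hXindep : iIndepFun X μ) (hXlaw : ∀ i, HasLaw (X i) Q μ) {a : ℝ} (ha : 0 < a)
    {H : (n : ℕ) → (Fin n → ℝ) → ProbabilityMeasure ℝ} {P : ℕ → Ω → ProbabilityMeasure ℝ}
    (hP : ∀ n, IsPosteriorDirichletProcess μ (P n) (firstSample X n) a (H n))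
    {A : Set ℝ} (hA : MeasurableSet A) :
    ∀ᵐ ω ∂μ, Tendsto (fun n => (P n ω : Measure ℝ).real A) atTop (𝓝 (Q.real A)) := by
  have hclose (k : ℕ) : ∀ᵐ ω ∂μ, ∀ᶠ n : ℕ in atTop,
      |(P n ω : Measure ℝ).real A - (empiricalDistribution (firstSample X n ω)).real A| <
        1 / ((k : ℝ) + 1) + a / (a + n) := by
    set ε : ℝ := 1 / ((k : ℝ) + 1) with hε
    have hε0 : 0 < ε := by positivity
    have hε1 : ε ≤ 1 := by
      rw [hε, div_le_one (by positivity)]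
      linarith [show (0 : ℝ) ≤ k by positivity]
    -- The index is shifted because the empirical measure of an empty sample is zero.
    have hsum : ∑' n : ℕ, μ {ω | ε + a / (a + (n + 1 : ℕ)) ≤
        |(P (n + 1) ω : Measure ℝ).real A -
          (empiricalDistribution (firstSample X (n + 1) ω)).real A|} ≠ ∞ := by
      have hs : Summable fun n : ℕ => 4608 / ε ^ 4 * (1 / ((n + 1 : ℕ) : ℝ) ^ 2) :=
        ((summable_nat_add_iff 1).2 (Real.summable_one_div_nat_pow.2 one_lt_two)).mul_left _
      refine ne_top_of_le_ne_top hs.tsum_ofReal_ne_top (ENNReal.tsum_le_tsum fun n => ?_)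
      refine ((hP (n + 1)).measure_le_abs_sub ha n.succ_ne_zero hA hε0 hε1).trans
        (ENNReal.ofReal_le_ofReal ?_)
      rw [div_mul_div_comm, mul_one]
      gcongr
      linarith
    filter_upwards [ae_eventually_notMem hsum] with ω hω
    obtain ⟨N, hN⟩ := eventually_atTop.1 hω
    refine eventually_atTop.2 ⟨N + 1, fun n hn => ?_⟩
    obtain ⟨m, rfl⟩ : ∃ m, n = m + 1 := ⟨n - 1, by omega⟩
    exact not_le.1 (hN m (by omega))
  filter_upwards [tendsto_real_empiricalDistribution hXindep hXlaw hA, ae_all_iff.2 hclose]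
    with ω hF hω
  have ha0 : Tendsto (fun n : ℕ => a / (a + n)) atTop (𝓝 0) :=
    tendsto_const_nhds.div_atTop (tendsto_atTop_add_const_left _ _ tendsto_natCast_atTop_atTop)
  have hdiff : Tendsto (fun n => (P n ω : Measure ℝ).real A -
      (empiricalDistribution (firstSample X n ω)).real A) atTop (𝓝 0) := by
    rw [Metric.tendsto_atTop']
    simp only [dist_zero_right, Real.norm_eq_abs]
    intro ε hε
    obtain ⟨k, hk⟩ := exists_nat_one_div_lt (half_pos hε)
    obtain ⟨N, hN⟩ := eventually_atTop.1
      ((hω k).and (ha0.eventually (gt_mem_nhds (half_pos hε))))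
    refine ⟨N, fun n hn => ?_⟩
    have := hN n hn.le
    linarith [this.1, this.2]
  simpa using hdiff.add hF

/-! ### Uniform convergence of distribution functions -/

/-- **Pólya's theorem**, in the form of uniform convergence of distribution functions that
converge at every rational to a continuous one. -/
lemma eventually_abs_cdf_sub_le {P : ℕ → Measure ℝ} {Q : Measure ℝ} (hQ : Continuous (cdf Q))
    (h : ∀ q : ℚ, Tendsto (fun n => cdf (P n) q) atTop (𝓝 (cdf Q q))) {ε : ℝ} (hε : 0 < ε) :
    ∀ᶠ n in atTop, ∀ z, |cdf (P n) z - cdf Q z| ≤ ε := by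
  have hnear (q : ℚ) : ∀ᶠ n in atTop, |cdf (P n) q - cdf Q q| < ε / 2 := by
    simpa [Real.dist_eq] using (h q).eventually (Metric.ball_mem_nhds _ (half_pos hε))
  obtain ⟨b, hb⟩ : ∃ b : ℚ, cdf Q b < ε / 2 := by
    obtain ⟨y, hy⟩ := ((tendsto_cdf_atBot Q).eventually (gt_mem_nhds (half_pos hε))).exists
    obtain ⟨b, hb⟩ := exists_rat_lt y
    exact ⟨b, (monotone_cdf Q hb.le).trans_lt hy⟩
  obtain ⟨c, hc⟩ : ∃ c : ℚ, 1 - ε / 2 < cdf Q c := by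
    obtain ⟨y, hy⟩ := ((tendsto_cdf_atTop Q).eventually
      (lt_mem_nhds (sub_lt_self 1 (half_pos hε)))).exists
    obtain ⟨c, hc⟩ := exists_rat_gt y
    exact ⟨c, hy.trans_le (monotone_cdf Q hc.le)⟩
  have hmid : ∀ᶠ n in atTop, ∀ z ∈ Set.Icc (b : ℝ) c, |cdf (P n) z - cdf Q z| ≤ ε := by
    refine isCompact_Icc.induction_on
      (p := fun s => ∀ᶠ n in atTop, ∀ z ∈ s, |cdf (P n) z - cdf Q z| ≤ ε) (by simp)
      (fun s t hst ht => ht.mono fun n hn z hz => hn z (hst hz))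
      (fun s t hs ht => by
        filter_upwards [hs, ht] with n h1 h2 z hz using hz.elim (h1 z) (h2 z))
      fun x _ => ?_
    -- Between `r` and `s` monotonicity squeezes both cdf's between their endpoint values: two
    -- oscillations of `ε / 4` and one endpoint error of `ε / 2` add up to `ε`.
    obtain ⟨δ, hδ, hx⟩ := Metric.continuous_iff.1 hQ x (ε / 4) (by positivity)
    obtain ⟨r, hr1, hr2⟩ := exists_rat_btwn (show x - δ < x by linarith)
    obtain ⟨s, hs1, hs2⟩ := exists_rat_btwn (show x < x + δ by linarith)
    refine ⟨Set.Ioo r s, mem_nhdsWithin_of_mem_nhds (Ioo_mem_nhds hr2 hs1), ?_⟩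
    filter_upwards [hnear r, hnear s] with n h1 h2 z hz
    have hr := abs_lt.1 (hx r (by rw [Real.dist_eq, abs_lt]; constructor <;> linarith))
    have hs := abs_lt.1 (hx s (by rw [Real.dist_eq, abs_lt]; constructor <;> linarith))
    have m1 := monotone_cdf (P n) hz.1.le
    have m2 := monotone_cdf (P n) hz.2.le
    have m3 := monotone_cdf Q hz.1.le
    have m4 := monotone_cdf Q hz.2.le
    rw [abs_lt] at h1 h2
    rw [abs_le]
    constructor <;> linarith [h1.1, h1.2, h2.1, h2.2, hr.1, hr.2, hs.1, hs.2]
  filter_upwards [hmid, hnear b, hnear c] with n h1 h2 h3 z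
  rw [abs_lt] at h2 h3
  rcases lt_or_ge z b with hzb | hzb
  · have m1 := monotone_cdf (P n) hzb.le
    have m2 := monotone_cdf Q hzb.le
    rw [abs_le]
    constructor <;> linarith [h2.1, h2.2, cdf_nonneg (P n) z, cdf_nonneg Q z]
  rcases lt_or_ge (c : ℝ) z with hzc | hzc
  · have m1 := monotone_cdf (P n) hzc.le
    have m2 := monotone_cdf Q hzc.le
    rw [abs_le]
    constructor <;> linarith [h3.1, h3.2, cdf_le_one (P n) z, cdf_le_one Q z]
  · exact h1 z ⟨hzb, hzc⟩

/-! ### Bounds for the Cramér–von Mises distance -/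

lemma abs_cdf_sub_cdf_le_one (P G : Measure ℝ) (z : ℝ) : |cdf P z - cdf G z| ≤ 1 := by
  rw [abs_le]
  constructor <;>
    linarith [cdf_nonneg P z, cdf_nonneg G z, cdf_le_one P z, cdf_le_one G z]

lemma abs_cdf_sub_cdf_le_iSup (P G : Measure ℝ) (z : ℝ) :
    |cdf P z - cdf G z| ≤ ⨆ z : ℝ, |cdf P z - cdf G z| :=
  le_ciSup (f := fun z : ℝ => |cdf P z - cdf G z|)
    ⟨1, Set.forall_mem_range.2 (abs_cdf_sub_cdf_le_one P G)⟩ z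

lemma dCvM_nonneg (P G : ProbabilityMeasure ℝ) : 0 ≤ dCvM P G :=
  integral_nonneg fun _ => sq_nonneg _

lemma dCvM_le_sq {P G : ProbabilityMeasure ℝ} {c : ℝ}
    (h : ∀ z, |cdf (P : Measure ℝ) z - cdf (G : Measure ℝ) z| ≤ c) : dCvM P G ≤ c ^ 2 := by
  have := norm_integral_le_of_norm_le_const (μ := (G : Measure ℝ))
    (f := fun z => (cdf (P : Measure ℝ) z - cdf (G : Measure ℝ) z) ^ 2) (C := c ^ 2)
    (ae_of_all _ fun z => by
      rw [norm_pow, Real.norm_eq_abs]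
      gcongr
      exact h z)
  rw [probReal_univ, mul_one] at this
  exact (le_abs_self _).trans this

lemma integrable_sq_cdf_sub_cdf (P G : Measure ℝ) [IsFiniteMeasure G] :
    Integrable (fun z => (cdf P z - cdf G z) ^ 2) G := by
  refine Integrable.of_bound (((monotone_cdf P).measurable.sub
    (monotone_cdf G).measurable).pow_const 2).aestronglyMeasurable 1 (ae_of_all _ fun z => ?_)
  rw [norm_pow, Real.norm_eq_abs]
  exact pow_le_one₀ (abs_nonneg _) (abs_cdf_sub_cdf_le_one P G z)

/-- A continuous distribution function takes each value strictly between its limits. -/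
lemma exists_cdf_eq {G : Measure ℝ} (hG : Continuous (cdf G)) {t : ℝ} (h0 : 0 < t) (h1 : t < 1) :
    ∃ w, cdf G w = t := by
  obtain ⟨u, hu⟩ := ((tendsto_cdf_atBot G).eventually (gt_mem_nhds h0)).exists
  obtain ⟨v, hv⟩ := ((tendsto_cdf_atTop G).eventually (lt_mem_nhds h1)).exists
  obtain ⟨w, hw⟩ := mem_range_of_exists_le_of_exists_ge hG ⟨u, hu.le⟩ ⟨v, hv.le⟩
  exact ⟨w, hw⟩

lemma real_Ioc_eq_cdf_sub_cdf (G : Measure ℝ) [IsProbabilityMeasure G] {u v : ℝ} (h : u ≤ v) :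
    G.real (Set.Ioc u v) = cdf G v - cdf G u := by
  have hs : Set.Ioc u v = Set.Iic v \ Set.Iic u := by
    ext x
    simp [and_comm]
  rw [hs, measureReal_sdiff (Set.Iic_subset_Iic.2 h) measurableSet_Iic, cdf_eq_real, cdf_eq_real]

/-- The Cramér–von Mises distance to a continuous distribution controls the difference of the
distribution functions at each point. -/
lemma abs_cdf_sub_cdf_pow_le_dCvM {P G : ProbabilityMeasure ℝ}
    (hG : Continuous (cdf (G : Measure ℝ))) (z : ℝ) :
    |cdf (P : Measure ℝ) z - cdf (G : Measure ℝ) z| ^ 3 / 8 ≤ dCvM P G := by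
  set d := |cdf (P : Measure ℝ) z - cdf (G : Measure ℝ) z| with hd
  rcases (abs_nonneg (cdf (P : Measure ℝ) z - cdf (G : Measure ℝ) z)).eq_or_lt with h0 | h0
  · rw [hd, ← h0]
    simpa using dCvM_nonneg P G
  rw [← hd] at h0
  -- If `P` is ahead at `z`, move right until `G` has gained `d / 2`: the cdf of `P` cannot drop, so
  -- half the gap survives on an interval of `G`-mass `d / 2`. If `P` is behind, move left.
  obtain ⟨u, v, huv, hmass, hdiff⟩ : ∃ u v : ℝ, u ≤ v ∧
      cdf (G : Measure ℝ) v - cdf (G : Measure ℝ) u = d / 2 ∧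
      ∀ y ∈ Set.Ioc u v, d / 2 ≤ |cdf (P : Measure ℝ) y - cdf (G : Measure ℝ) y| := by
    have hP0 := cdf_nonneg (P : Measure ℝ) z
    have hP1 := cdf_le_one (P : Measure ℝ) z
    have hG0 := cdf_nonneg (G : Measure ℝ) z
    have hG1 := cdf_le_one (G : Measure ℝ) z
    rcases abs_cases (cdf (P : Measure ℝ) z - cdf (G : Measure ℝ) z) with ⟨he, _⟩ | ⟨he, _⟩
    · rw [← hd] at he
      obtain ⟨w, hw⟩ := exists_cdf_eq hG (t := cdf (G : Measure ℝ) z + d / 2)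
        (by linarith) (by linarith)
      have hzw : z ≤ w := by
        by_contra! hlt
        linarith [monotone_cdf (G : Measure ℝ) hlt.le]
      refine ⟨z, w, hzw, by linarith, fun y hy => le_trans ?_ (le_abs_self _)⟩
      linarith [monotone_cdf (P : Measure ℝ) hy.1.le, monotone_cdf (G : Measure ℝ) hy.2]
    · rw [← hd] at he
      obtain ⟨w, hw⟩ := exists_cdf_eq hG (t := cdf (G : Measure ℝ) z - d / 2)
        (by linarith) (by linarith)
      have hzw : w ≤ z := by
        by_contra! hlt
        linarith [monotone_cdf (G : Measure ℝ) hlt.le]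
      refine ⟨w, z, hzw, by linarith, fun y hy => le_trans ?_ (neg_le_abs _)⟩
      linarith [monotone_cdf (P : Measure ℝ) hy.2, monotone_cdf (G : Measure ℝ) hy.1.le]
  have hint := integrable_sq_cdf_sub_cdf (P : Measure ℝ) (G : Measure ℝ)
  calc d ^ 3 / 8 = (d / 2) ^ 2 * (G : Measure ℝ).real (Set.Ioc u v) := by
        rw [real_Ioc_eq_cdf_sub_cdf _ huv, hmass]
        ring
    _ = ∫ _ in Set.Ioc u v, (d / 2) ^ 2 ∂(G : Measure ℝ) := by
        rw [setIntegral_const, smul_eq_mul, mul_comm]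
    _ ≤ ∫ y in Set.Ioc u v, (cdf (P : Measure ℝ) y - cdf (G : Measure ℝ) y) ^ 2
          ∂(G : Measure ℝ) := by
        refine setIntegral_mono_on (integrable_const _).integrableOn hint.integrableOn
          measurableSet_Ioc fun y hy => ?_
        rw [← sq_abs (cdf (P : Measure ℝ) y - _)]
        have := hdiff y hy
        gcongr
    _ ≤ dCvM P G := setIntegral_le_integral hint (ae_of_all _ fun _ => sq_nonneg _)

/-- Distinct probability measures on the line have distribution functions that differ at a
rational. -/
lemma exists_rat_cdf_ne {P Q : ProbabilityMeasure ℝ} (h : P ≠ Q) :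
    ∃ q : ℚ, cdf (P : Measure ℝ) q ≠ cdf (Q : Measure ℝ) q := by
  by_contra! hq
  refine h (Subtype.ext (Measure.eq_of_cdf (P : Measure ℝ) (Q : Measure ℝ) (StieltjesFunction.ext fun x => ?_)))
  rw [← (cdf (P : Measure ℝ)).iInf_rat_gt_eq x, ← (cdf (Q : Measure ℝ)).iInf_rat_gt_eq x]
  exact iInf_congr fun r => hq r

/-! ### The two cases -/

theorem lemma3
    {Ω : Type*} [MeasurableSpace Ω] (μ : Measure Ω) [IsProbabilityMeasure μ]
    {Θ : Type*} [TopologicalSpace Θ]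
    -- the model, with continuous cdf's
    (F : Θ → ProbabilityMeasure ℝ) (hF : ∀ θ, Continuous (cdf (F θ : Measure ℝ)))
    -- the i.i.d. data and their true distribution
    (Q : ProbabilityMeasure ℝ) (X : ℕ → Ω → ℝ) (hXindep : iIndepFun X μ)
    (hXlaw : ∀ i, HasLaw (X i) (Q : Measure ℝ) μ)
    -- `θ₀` minimizes a divergence between the true distribution and the model
    (D : ProbabilityMeasure ℝ → ProbabilityMeasure ℝ → ℝ≥0∞) (hD : IsDivergence D)
    (θ₀ : Θ) (hθ₀ : ∀ θ, D Q (F θ₀) ≤ D Q (F θ))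
    -- the posterior Dirichlet processes
    (a : ℝ) (ha : 0 < a) (H : (n : ℕ) → (Fin n → ℝ) → ProbabilityMeasure ℝ)
    (P : ℕ → Ω → ProbabilityMeasure ℝ)
    (hP : ∀ n, IsPosteriorDirichletProcess μ (P n) (firstSample X n) a (H n))
    -- the estimator
    (θhat : (n : ℕ) → (Fin n → ℝ) → Θ)
    (hθhat : ∀ᵐ ω ∂μ, Tendsto (fun n => θhat n (firstSample X n ω)) atTop (𝓝 θ₀))
    (hFθhat : ∀ᵐ ω ∂μ, Tendsto
      (fun n => ⨆ z : ℝ, |cdf (F (θhat n (firstSample X n ω)) : Measure ℝ) z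
        - cdf (F θ₀ : Measure ℝ) z|) atTop (𝓝 0)) :
    (Q ∈ Set.range F →
      ∀ᵐ ω ∂μ, Tendsto (fun n => dCvM (P n ω) (F (θhat n (firstSample X n ω)))) atTop (𝓝 0)) ∧
    (Q ∉ Set.range F →
      ∀ᵐ ω ∂μ, 0 < liminf (fun n => dCvM (P n ω) (F (θhat n (firstSample X n ω)))) atTop) := by
  have hcdf : ∀ᵐ ω ∂μ, ∀ q : ℚ, Tendsto (fun n => cdf (P n ω : Measure ℝ) q) atTop
      (𝓝 (cdf (Q : Measure ℝ) q)) := by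
    simp only [cdf_eq_real]
    exact ae_all_iff.2 fun q => tendsto_real_posterior hXindep hXlaw ha hP measurableSet_Iic
  constructor
  · rintro ⟨θ, hθ⟩
    have hQ : Q = F θ₀ := by
      have h := hθ₀ θ
      rw [(hD Q (F θ) (hF θ)).2 hθ.symm] at h
      exact (hD Q (F θ₀) (hF θ₀)).1 (nonpos_iff_eq_zero.1 h)
    filter_upwards [hcdf, hFθhat] with ω hω hsup
    rw [Metric.tendsto_atTop']
    intro ε hε
    -- The distance is at most `(2 * c) ^ 2 = (min 1 ε) ^ 2 / 4`, which is less than `ε`.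
    set c := min 1 ε / 4 with hc
    have hc0 : 0 < c := by positivity
    have hev := (eventually_abs_cdf_sub_le (hQ ▸ hF θ₀) hω hc0).and
      (hsup.eventually (gt_mem_nhds hc0))
    obtain ⟨N, hN⟩ := eventually_atTop.1 hev
    refine ⟨N, fun n hn => ?_⟩
    obtain ⟨h1, h2⟩ := hN n hn.le
    have h := dCvM_le_sq (P := P n ω) (G := F (θhat n (firstSample X n ω))) (c := 2 * c)
      fun z => by
        have h3 := abs_cdf_sub_cdf_le_iSup (F (θhat n (firstSample X n ω)) : Measure ℝ)
          (F θ₀ : Measure ℝ) z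
        have h4 := abs_sub_le (cdf (P n ω : Measure ℝ) z) (cdf (Q : Measure ℝ) z)
          (cdf (F (θhat n (firstSample X n ω)) : Measure ℝ) z)
        have h5 := h1 z
        rw [← hQ] at h2 h3
        rw [abs_sub_comm (cdf (Q : Measure ℝ) z)] at h4
        linarith
    rw [Real.dist_eq, sub_zero, abs_of_nonneg (dCvM_nonneg _ _)]
    have h6 := min_le_left 1 ε
    have h7 := min_le_right 1 ε
    nlinarith
  · intro hQ
    obtain ⟨q, hq⟩ := exists_rat_cdf_ne (fun h : F θ₀ = Q => hQ ⟨θ₀, h⟩)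
    filter_upwards [hcdf, hFθhat] with ω hω hsup
    have hG : Tendsto (fun n => cdf (F (θhat n (firstSample X n ω)) : Measure ℝ) q) atTop
        (𝓝 (cdf (F θ₀ : Measure ℝ) q)) := by
      rw [tendsto_iff_dist_tendsto_zero]
      exact squeeze_zero (fun _ => dist_nonneg)
        (fun n => abs_cdf_sub_cdf_le_iSup _ _ (q : ℝ)) hsup
    have hlow : Tendsto (fun n => |cdf (P n ω : Measure ℝ) q -
        cdf (F (θhat n (firstSample X n ω)) : Measure ℝ) q| ^ 3 / 8) atTop
        (𝓝 (|cdf (Q : Measure ℝ) q - cdf (F θ₀ : Measure ℝ) q| ^ 3 / 8)) :=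
      ((((hω q).sub hG).abs).pow 3).div_const 8
    have hpos : 0 < |cdf (Q : Measure ℝ) q - cdf (F θ₀ : Measure ℝ) q| ^ 3 / 8 := by
      have := abs_pos.2 (sub_ne_zero.2 hq.symm)
      positivity
    -- A real `liminf` takes a default value when the eventual lower bounds are unbounded; an upper
    -- bound on the distance excludes this.
    have hbdd : IsBoundedUnder (· ≤ ·) atTop
        fun n => dCvM (P n ω) (F (θhat n (firstSample X n ω))) :=
      isBoundedUnder_of ⟨1 ^ 2, fun n => dCvM_le_sq (abs_cdf_sub_cdf_le_one _ _)⟩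
    calc _ < _ := hpos
      _ = _ := hlow.liminf_eq.symm
      _ ≤ _ := liminf_le_liminf
          (Eventually.of_forall fun n => abs_cdf_sub_cdf_pow_le_dCvM (hF _) _)
          hlow.isBoundedUnder_ge hbdd.isCoboundedUnder_ge
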